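/- Let $q>2$ be a prime power, and let $V$ be a $3$-dimensional vector space over $\mathbb F_{q^3}$. Then $V$ has dimension $9$ over $\mathbb F_q$; write $\mathrm{PG}(2,q^3)$ and $\mathrm{PG}(8,q)$ for the projective spaces of $V$ over $\mathbb F_{q^3}$ and over $\mathbb F_q$. Each point $\bar P$ of $\mathrm{PG}(2,q^3)$, being a $1$-dimensional $\mathbb F_{q^3}$-subspace of $V$, is a $3$-dimensional $\mathbb F_q$-subspace, hence a plane $[\![P]\!]$ of $\mathrm{PG}(8,q)$; these planes form a regular (Desarguesian) $2$-spread of $\mathrm{PG}(8,q)$. Let $\phi$ be a collineation of $\mathrm{PG}(2,q^3)$ of order $3$ which fixes pointwise an $\mathbb F_q$-plane, that is, the set of all points having coordinates in $\mathbb F_q$ with respect to some $\mathbb F_{q^3}$-basis of $V$. Let $\sigma\in\mathrm{PGL}(9,q)$ be a projectivity of $\mathrm{PG}(8,q)$ induced by $\phi$, that is, $\sigma$ maps $[\![P]\!]$ onto $[\![P^\phi]\!]$ for every point $\bar P$ of $\mathrm{PG}(2,q^3)$. A point $\bar P$ of $\mathrm{PG}(2,q^3)$ has Type I if $\bar P^\phi=\bar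 P$, and Type II if $\bar P,\bar P^\phi,\bar P^{\phi^2}$ are three distinct collinear points. A point $A$ of $\mathrm{PG}(8,q)$ is a $\mathrm I_:$-point if it lies in $[\![P]\!]$ for some $\bar P$ of Type I and $A,A^\sigma,A^{\sigma^2}$ are distinct and collinear; it is a $\mathrm{II}_:$-point if it lies in $[\![P]\!]$ for some $\bar P$ of Type II and $A,A^\sigma,A^{\sigma^2}$ are collinear. For $X\in\{\mathrm I,\mathrm{II}\}$, a fixed-$X$-line is a line of $\mathrm{PG}(8,q)$ that is fixed (setwise) by $\sigma$ and contains an $X_:$-point. A hwise-fixed $5$-space is a $5$-dimensional projective subspace of $\mathrm{PG}(8,q)$ such that every hyperplane of $\mathrm{PG}(8,q)$ containing it is fixed by $\sigma$. Then: 1. every $\mathrm I_:$-point and every $\mathrm{II}_:$-point of $\mathrm{PG}(8,q)$ is contained in a unique hwise-fixed $5$-space; 2. every fixed-$\mathrm I$-line and every fixed-$\mathrm{II}$-line is contained in a unique hwise-fixed $5$-space. -/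

import Mathlib

open scoped LinearAlgebra.Projectivization

namespace FieldReduction

section General

variable {F E : Type*} [Field F] [AddCommGroup E] [Module F E]

/-- A linear subspace `U` of `E`, seen as a subspace of the projective space of `E`, has
projective dimension `d` (a line has `d = 1`, a plane has `d = 2`). -/
def HasProjDim (U : Submodule F E) (d : ℕ) : Prop :=
  Module.finrank F U = d + 1

/-- Three (not necessarily distinct) points of a projective space lie on a common line. -/
def CollinearPoints (P Q R : ℙ F E) : Prop :=
  Projectivization.IsCollinear {P, Q, R}

/-- The points `P, Q, R` are pairwise distinct and lie on a common line. -/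
def ThreeCollinear (P Q R : ℙ F E) : Prop :=
  P ≠ Q ∧ Q ≠ R ∧ P ≠ R ∧ CollinearPoints P Q R

/-- A permutation of the points of a projective space is a collineation if it preserves
collinearity in both directions. -/
def IsCollineation (φ : Equiv.Perm (ℙ F E)) : Prop :=
  ∀ P Q R : ℙ F E, CollinearPoints (φ P) (φ Q) (φ R) ↔ CollinearPoints P Q R

/-- The action on points of the projectivity given by an invertible linear map. -/
def proj (g : E ≃ₗ[F] E) : ℙ F E → ℙ F E :=
  Projectivization.map (g : E →ₗ[F] E) g.injective

/-- The projectivity given by `g` fixes the subspace `U` (setwise). -/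
def Fixes (g : E ≃ₗ[F] E) (U : Submodule F E) : Prop :=
  U.map (g : E →ₗ[F] E) = U

end General

section Bose

variable (K : Type*) {L V : Type*} [Field K] [Field L] [Algebra K L] [AddCommGroup V]
  [Module L V] [Module K V] [IsScalarTower K L V]

/-- `S` is a `K`-plane (a subplane over `K`) of the projective plane `ℙ L V`: for some `L`-basis
of `V`, it is the set of points with homogeneous coordinates in `K`. -/
def IsSubplane (S : Set (ℙ L V)) : Prop :=
  ∃ b : Module.Basis (Fin 3) L V,
    S = {P | ∃ (k : Fin 3 → K) (h : ∑ i, algebraMap K L (k i) • b i ≠ 0),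
      P = Projectivization.mk L (∑ i, algebraMap K L (k i) • b i) h}

/-- The spread plane of `ℙ K V` that corresponds to the point `P` of `ℙ L V`. -/
def spreadPlane (P : ℙ L V) : Submodule K V :=
  P.submodule.restrictScalars K

variable {K}

/-- The projectivity of `ℙ K V` given by `g` is induced by the permutation `φ` of the points of
`ℙ L V`: it acts on the spread planes as `φ` acts on the points. -/
def IsInducedBy (g : V ≃ₗ[K] V) (φ : Equiv.Perm (ℙ L V)) : Prop :=
  ∀ P : ℙ L V, (spreadPlane K P).map (g : V →ₗ[K] V) = spreadPlane K (φ P)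

/-- The orbit of the point `P` of `ℙ L V` under `φ` is a single point. -/
def IsTypeI (φ : Equiv.Perm (ℙ L V)) (P : ℙ L V) : Prop :=
  φ P = P

/-- The orbit of the point `P` of `ℙ L V` under `φ` (of order `3`) is three collinear points. -/
def IsTypeII (φ : Equiv.Perm (ℙ L V)) (P : ℙ L V) : Prop :=
  ThreeCollinear P (φ P) (φ (φ P))

/-- A point of `ℙ K V` that lies in the spread plane of a Type I point. -/
def IsIPoint (φ : Equiv.Perm (ℙ L V)) (A : ℙ K V) : Prop :=
  ∃ P : ℙ L V, IsTypeI φ P ∧ A.submodule ≤ spreadPlane K P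

/-- A point of `ℙ K V` that lies in the spread plane of a Type II point. -/
def IsIIPoint (φ : Equiv.Perm (ℙ L V)) (A : ℙ K V) : Prop :=
  ∃ P : ℙ L V, IsTypeII φ P ∧ A.submodule ≤ spreadPlane K P

/-- `I:`-points: I-points with `A`, `A^σ`, `A^σ²` distinct and collinear. -/
def IsIColonPoint (φ : Equiv.Perm (ℙ L V)) (g : V ≃ₗ[K] V) (A : ℙ K V) : Prop :=
  IsIPoint φ A ∧ ThreeCollinear A (proj g A) (proj g (proj g A))

/-- `II:`-points: II-points with `A`, `A^σ`, `A^σ²` collinear. -/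
def IsIIColonPoint (φ : Equiv.Perm (ℙ L V)) (g : V ≃ₗ[K] V) (A : ℙ K V) : Prop :=
  IsIIPoint φ A ∧ CollinearPoints A (proj g A) (proj g (proj g A))

/-- A fixed-I-line: a fixed line of `ℙ K V` containing an `I:`-point. -/
def IsFixedILine (φ : Equiv.Perm (ℙ L V)) (g : V ≃ₗ[K] V) (l : Submodule K V) : Prop :=
  HasProjDim l 1 ∧ Fixes g l ∧ ∃ A : ℙ K V, IsIColonPoint φ g A ∧ A.submodule ≤ l

/-- A fixed-II-line: a fixed line of `ℙ K V` containing a `II:`-point. -/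
def IsFixedIILine (φ : Equiv.Perm (ℙ L V)) (g : V ≃ₗ[K] V) (l : Submodule K V) : Prop :=
  HasProjDim l 1 ∧ Fixes g l ∧ ∃ A : ℙ K V, IsIIColonPoint φ g A ∧ A.submodule ≤ l

/-- A hyperplane-wise fixed 5-space of `ℙ K V` (of projective dimension 8): every hyperplane
(7-space) through it is fixed. -/
def IsHwiseFixed5Space (g : V ≃ₗ[K] V) (U : Submodule K V) : Prop :=
  HasProjDim U 5 ∧ ∀ H : Submodule K V, HasProjDim H 7 → U ≤ H → Fixes g H

end Bose

end FieldReduction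

/-! In a basis `b` whose `K`-coordinate points are fixed by `φ`, the map `σ` is semilinear: `σ (x •
b i) = (c * θ x) • b i`, with `θ` a `K`-automorphism of `L` of order 3. Hence `σ³` is the scalar `n
= c · θ c · θ² c`, which is fixed by `θ` and so lies in `K`.

If every hyperplane through a 5-space `U` is fixed, the annihilator of `U` consists of eigenvectors
of the transpose of `σ`, all for one eigenvalue `a`. So `U` contains the image of `σ - a`, and `a³ =
n`. A Hilbert 90 argument gives that image vector dimension 6, hence the hwise-fixed 5-spaces are
exactly the images of `σ - a` with `a³ = n`. Such an image is also the kernel of `σ² + aσ + a²`.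

A nonfixed point `⟨v⟩` collinear with its images is killed by a monic quadratic in `σ`, which must
divide `T³ - n` and so equals `T² + aT + a²` for exactly one `a`. That `a` picks out the unique
5-space. A fixed line through `⟨v⟩` is spanned by `v` and `σ v`, so it lies in the same 5-space. -/

namespace FieldReduction

/-! ### Linear algebra of a map whose cube is scalar -/

section Linear

variable {K V : Type*} [Field K] [AddCommGroup V] [Module K V]

/-- The endomorphism `g - a` of `V`. -/
def subScalar (g : V ≃ₗ[K] V) (a : K) : V →ₗ[K] V :=
  (g : V →ₗ[K] V) - a • LinearMap.id

/-- The endomorphism `g² + a g + a²` of `V`. -/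
def cofactor (g : V ≃ₗ[K] V) (a : K) : V →ₗ[K] V :=
  (g : V →ₗ[K] V) ∘ₗ (g : V →ₗ[K] V) + a • (g : V →ₗ[K] V) + (a ^ 2) • LinearMap.id

@[simp]
theorem subScalar_apply (g : V ≃ₗ[K] V) (a : K) (v : V) : subScalar g a v = g v - a • v := by
  simp [subScalar]

@[simp]
theorem cofactor_apply (g : V ≃ₗ[K] V) (a : K) (v : V) :
    cofactor g a v = g (g v) + a • g v + a ^ 2 • v := by
  simp [cofactor]

theorem cofactor_subScalar {g : V ≃ₗ[K] V} {a : K} (hg : ∀ v, g (g (g v)) = a ^ 3 • v) (v : V) :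
    cofactor g a (subScalar g a v) = 0 := by
  simp only [subScalar_apply, cofactor_apply, map_sub, map_smul, hg]
  module

theorem subScalar_cofactor {g : V ≃ₗ[K] V} {a : K} (hg : ∀ v, g (g (g v)) = a ^ 3 • v) (v : V) :
    subScalar g a (cofactor g a v) = 0 := by
  simp only [subScalar_apply, cofactor_apply, map_add, map_smul, hg]
  module

theorem fixes_of_forall_mem [FiniteDimensional K V] {g : V ≃ₗ[K] V} {H : Submodule K V}
    (h : ∀ v ∈ H, g v ∈ H) : Fixes g H :=
  Submodule.eq_of_le_of_finrank_eq (Submodule.map_le_iff_le_comap.2 h)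
    (LinearEquiv.finrank_map_eq g H)

theorem isHwiseFixed5Space_range_subScalar [FiniteDimensional K V] {g : V ≃ₗ[K] V} {a : K}
    (h : HasProjDim (LinearMap.range (subScalar g a)) 5) :
    IsHwiseFixed5Space g (LinearMap.range (subScalar g a)) := by
  refine ⟨h, fun H _ hH => fixes_of_forall_mem fun v hv => ?_⟩
  have h1 := H.add_mem (hH ⟨v, rfl⟩) (H.smul_mem a hv)
  simpa using h1

/-- A functional that vanishes on a hwise-fixed 5-space is an eigenvector of the transpose. -/
theorem IsHwiseFixed5Space.exists_apply_eq_mul [FiniteDimensional K V] {g : V ≃ₗ[K] V}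
    {U : Submodule K V} (hU : IsHwiseFixed5Space g U) (hV : Module.finrank K V = 9)
    (ψ : Module.Dual K V) (hψ : ψ ∈ U.dualAnnihilator) : ∃ c : K, ∀ v, ψ (g v) = c * ψ v := by
  by_cases h0 : ψ = 0
  · exact ⟨0, by simp [h0]⟩
  have hker := Module.Dual.finrank_ker_add_one_of_ne_zero h0
  have hfix : Fixes g (LinearMap.ker ψ) := hU.2 _ (by unfold HasProjDim; omega)
    fun u hu => (Submodule.mem_dualAnnihilator ψ).1 hψ u hu
  obtain ⟨w, hw⟩ : ∃ w, ψ w = 1 := LinearMap.surjective h0 1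
  refine ⟨ψ (g w), fun v => ?_⟩
  have h1 : v - ψ v • w ∈ LinearMap.ker ψ := by simp [hw]
  have h2 : g (v - ψ v • w) ∈ LinearMap.ker ψ := by
    rw [← hfix]
    exact Submodule.mem_map_of_mem h1
  simp only [map_sub, map_smul, LinearMap.mem_ker, smul_eq_mul, sub_eq_zero] at h2
  rw [h2, mul_comm]

/-- A linear map all of whose values on a subspace are multiples of the argument acts on that
subspace as a scalar. -/
theorem exists_forall_apply_eq_smul (T : V →ₗ[K] V) (W : Submodule K V)
    (h : ∀ w ∈ W, ∃ c : K, T w = c • w) : ∃ a : K, ∀ w ∈ W, T w = a • w := by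
  have hT : ∀ w ∈ W, T w ∈ W := by
    intro w hw
    obtain ⟨c, hc⟩ := h w hw
    exact hc ▸ W.smul_mem c hw
  have hdep : ∀ w : W, ¬ LinearIndependent K ![w, T.restrict hT w] := by
    intro w hli
    obtain ⟨c, hc⟩ := h w w.2
    have := LinearIndependent.pair_iff.1 hli c (-1) (by
      ext
      simp [hc])
    simpa using this.2
  obtain ⟨a, ha⟩ := LinearMap.exists_eq_smul_id_of_forall_notLinearIndependent hdep
  exact ⟨a, fun w hw => congrArg Subtype.val (LinearMap.congr_fun ha ⟨w, hw⟩)⟩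

/-- The transpose of `g` acts on the annihilator of `U` as one scalar `a`, so that annihilator kills
the image of `g - a`; double annihilation puts the image in `U`. -/
theorem IsHwiseFixed5Space.exists_range_subScalar_le [FiniteDimensional K V] {g : V ≃ₗ[K] V}
    {U : Submodule K V} (hU : IsHwiseFixed5Space g U) (hV : Module.finrank K V = 9) :
    ∃ a : K, LinearMap.range (subScalar g a) ≤ U := by
  obtain ⟨a, ha⟩ := exists_forall_apply_eq_smul (g : V →ₗ[K] V).dualMap U.dualAnnihilator (by
    intro ψ hψ
    obtain ⟨c, hc⟩ := hU.exists_apply_eq_mul hV ψ hψ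
    exact ⟨c, LinearMap.ext hc⟩)
  refine ⟨a, ?_⟩
  rintro _ ⟨v, rfl⟩
  rw [← Subspace.forall_mem_dualAnnihilator_apply_eq_zero_iff]
  intro ψ hψ
  have h : ψ (g v) = a * ψ v := LinearMap.congr_fun (ha ψ hψ) v
  simp [h]

theorem IsHwiseFixed5Space.exists_eq_range_subScalar [FiniteDimensional K V] {g : V ≃ₗ[K] V}
    {U : Submodule K V} (hU : IsHwiseFixed5Space g U) (hV : Module.finrank K V = 9) {n : K}
    (hg : ∀ v, g (g (g v)) = n • v)
    (hrange : ∀ a : K, a ^ 3 = n → HasProjDim (LinearMap.range (subScalar g a)) 5) :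
    ∃ a : K, a ^ 3 = n ∧ U = LinearMap.range (subScalar g a) := by
  obtain ⟨a, ha⟩ := hU.exists_range_subScalar_le hV
  -- Modulo the proper subspace `U`, `g` acts as `a` while `g³` acts as `n`.
  have hn : a ^ 3 = n := by
    have hne : U ≠ ⊤ := by
      rintro rfl
      have := hU.1
      rw [HasProjDim, finrank_top] at this
      omega
    obtain ⟨v, hv⟩ : ∃ v, v ∉ U := by
      by_contra! h
      exact hne (Submodule.eq_top_iff'.2 h)
    have hmem : ∀ v, g v - a • v ∈ U := fun v => by simpa using ha ⟨v, rfl⟩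
    by_contra hne'
    refine hv ((U.smul_mem_iff (sub_ne_zero.2 (Ne.symm hne'))).1 ?_)
    have h3 := U.add_mem (U.add_mem (hmem (g (g v))) (U.smul_mem a (hmem (g v))))
      (U.smul_mem (a ^ 2) (hmem v))
    rw [hg] at h3
    convert h3 using 1
    module
  refine ⟨a, hn, (Submodule.eq_of_le_of_finrank_eq ha ?_).symm⟩
  rw [(hrange a hn : Module.finrank K _ = _), (hU.1 : Module.finrank K _ = _)]

/-- The quadratic `T² - αT - β` annihilating `v` must divide `T³ - n`, which forces `β = -α²` and `a
= -α`. -/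
theorem exists_cofactor_eq_zero {g : V ≃ₗ[K] V} {n : K} (hg : ∀ v, g (g (g v)) = n • v)
    {v : V} (hli : LinearIndependent K ![v, g v])
    (hdep : ∃ α β : K, g (g v) = α • g v + β • v) :
    ∃ a : K, a ^ 3 = n ∧ cofactor g a v = 0 := by
  obtain ⟨α, β, h⟩ := hdep
  have h3 : g (g (g v)) = α • g (g v) + β • g v := by
    conv_lhs => rw [h]
    simp
  rw [hg, h] at h3
  obtain ⟨h4, h5⟩ := LinearIndependent.pair_iff.1 hli (α * β - n) (α ^ 2 + β) (by
    linear_combination (norm := module) -h3)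
  have hβ : β = -α ^ 2 := by linear_combination h5
  refine ⟨-α, by linear_combination h4 - α * h5, ?_⟩
  rw [cofactor_apply, h, hβ]
  module

theorem eq_of_cofactor_eq_zero {g : V ≃ₗ[K] V} {v : V} (hli : LinearIndependent K ![v, g v])
    {a b : K} (ha : cofactor g a v = 0) (hb : cofactor g b v = 0) : a = b := by
  have h := (LinearIndependent.pair_iff.1 hli (a ^ 2 - b ^ 2) (a - b) (by
    rw [cofactor_apply] at ha hb
    linear_combination (norm := module) ha - hb)).2
  exact sub_eq_zero.1 h

/-- A point that is not fixed but spans, with its images, a line at most, lies in a unique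
hwise-fixed 5-space. -/
theorem existsUnique_isHwiseFixed5Space_mem [FiniteDimensional K V] {g : V ≃ₗ[K] V}
    (hV : Module.finrank K V = 9) {n : K} (hg : ∀ v, g (g (g v)) = n • v)
    (hrange : ∀ a : K, a ^ 3 = n → HasProjDim (LinearMap.range (subScalar g a)) 5 ∧
      LinearMap.ker (cofactor g a) ≤ LinearMap.range (subScalar g a))
    {v : V} (hli : LinearIndependent K ![v, g v])
    (hdep : ∃ α β : K, g (g v) = α • g v + β • v) :
    ∃ U : Submodule K V, (IsHwiseFixed5Space g U ∧ v ∈ U ∧ g v ∈ U) ∧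
      ∀ W, IsHwiseFixed5Space g W → v ∈ W → W = U := by
  obtain ⟨a, han, ha⟩ := exists_cofactor_eq_zero hg hli hdep
  have hv : v ∈ LinearMap.range (subScalar g a) := (hrange a han).2 ha
  refine ⟨_, ⟨isHwiseFixed5Space_range_subScalar (hrange a han).1, hv, ?_⟩, fun W hW hvW => ?_⟩
  · have h1 := Submodule.add_mem _ (⟨v, rfl⟩ : subScalar g a v ∈ LinearMap.range (subScalar g a))
      (Submodule.smul_mem _ a hv)
    simpa using h1
  · obtain ⟨b, hbn, rfl⟩ := hW.exists_eq_range_subScalar hV hg fun a ha => (hrange a ha).1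
    obtain ⟨w, rfl⟩ := hvW
    rw [eq_of_cofactor_eq_zero hli ha (cofactor_subScalar (by simpa [hbn] using hg) w)]

end Linear

/-! ### Coordinates: an inducing map is semilinear -/

section Semilinear

theorem map_sum_smul {K L V : Type*} [Field K] [Field L] [Algebra K L] [AddCommGroup V]
    [Module L V] [Module K V] {g : V ≃ₗ[K] V} {b : Module.Basis (Fin 3) L V} {θ : L →ₐ[K] L}
    {c : L} (h : ∀ x i, g (x • b i) = (c * θ x) • b i) (x : Fin 3 → L) :
    g (∑ i, x i • b i) = ∑ i, (c * θ (x i)) • b i := by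
  simp [h]

variable {K L V : Type*} [Field K] [Field L] [Algebra K L] [AddCommGroup V]
  [Module L V] [Module K V] [IsScalarTower K L V]

theorem IsInducedBy.apply_mem {g : V ≃ₗ[K] V} {φ : Equiv.Perm (ℙ L V)} (hg : IsInducedBy g φ)
    {P : ℙ L V} {v : V} (hv : v ∈ P.submodule) : g v ∈ (φ P).submodule := by
  have h : g v ∈ (spreadPlane K P).map (g : V →ₗ[K] V) := Submodule.mem_map_of_mem hv
  rwa [hg P] at h

theorem eq_mk_of_mem_submodule {P : ℙ L V} {v : V} (hv : v ≠ 0) (h : v ∈ P.submodule) :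
    P = Projectivization.mk L v hv := by
  induction P using Projectivization.ind with | h w hw =>
  rw [Projectivization.submodule_mk, Submodule.mem_span_singleton] at h
  exact ((Projectivization.mk_eq_mk_iff' L _ _ hv hw).2 h).symm

theorem IsInducedBy.apply_mk {g : V ≃ₗ[K] V} {φ : Equiv.Perm (ℙ L V)} (hg : IsInducedBy g φ)
    {v : V} (hv : v ≠ 0) :
    φ (Projectivization.mk L v hv) =
      Projectivization.mk L (g v) (g.map_ne_zero_iff.2 hv) :=
  eq_mk_of_mem_submodule _ (hg.apply_mem (by simp [Submodule.mem_span_singleton_self]))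

theorem IsInducedBy.exists_map_smul {g : V ≃ₗ[K] V} {φ : Equiv.Perm (ℙ L V)}
    (hg : IsInducedBy g φ) (x : L) (v : V) : ∃ y : L, g (x • v) = y • g v := by
  by_cases hv : v = 0
  · exact ⟨0, by simp [hv]⟩
  have h : x • v ∈ (Projectivization.mk L v hv).submodule := by
    rw [Projectivization.submodule_mk]
    exact Submodule.smul_mem _ _ (Submodule.mem_span_singleton_self v)
  have h' := hg.apply_mem h
  rw [hg.apply_mk, Projectivization.submodule_mk, Submodule.mem_span_singleton] at h'
  obtain ⟨y, hy⟩ := h'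
  exact ⟨y, hy.symm⟩

theorem IsInducedBy.exists_map_smul_of_fixed {g : V ≃ₗ[K] V} {φ : Equiv.Perm (ℙ L V)}
    (hg : IsInducedBy g φ) {v : V} (hv : v ≠ 0)
    (hfix : φ (Projectivization.mk L v hv) = Projectivization.mk L v hv) (x : L) :
    ∃ y : L, g (x • v) = y • v := by
  obtain ⟨y, hy⟩ := hg.exists_map_smul x v
  rw [hg.apply_mk, Projectivization.mk_eq_mk_iff'] at hfix
  obtain ⟨z, hz⟩ := hfix
  exact ⟨y * z, by rw [hy, ← hz, mul_smul]⟩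

/-- On the coordinate vectors of a subplane that is fixed pointwise, an inducing linear map acts
through a single `K`-linear endomorphism of `L`. -/
theorem IsInducedBy.exists_map_smul_basis {g : V ≃ₗ[K] V} {φ : Equiv.Perm (ℙ L V)}
    (hg : IsInducedBy g φ) (b : Module.Basis (Fin 3) L V)
    (hfix : ∀ (k : Fin 3 → K) (h : ∑ i, algebraMap K L (k i) • b i ≠ 0),
      φ (Projectivization.mk L _ h) = Projectivization.mk L _ h) :
    ∃ f : L →ₗ[K] L, ∀ x i, g (x • b i) = f x • b i := by
  have hfix' : ∀ (k : Fin 3 → K) (v : V) (hv : v ≠ 0), ∑ i, algebraMap K L (k i) • b i = v →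
      ∀ x : L, ∃ y : L, g (x • v) = y • v := by
    rintro k _ hv rfl x
    exact hg.exists_map_smul_of_fixed hv (hfix k hv) x
  have h1 : ∀ i (x : L), ∃ y : L, g (x • b i) = y • b i := fun i =>
    hfix' (Pi.single i 1) _ (b.ne_zero i)
      (by simp [Pi.single_apply, apply_ite (algebraMap K L), ite_smul])
  -- The fixed points `b i + b j` force the coefficient functions on the different axes to agree.
  have h2 : ∀ i j, i ≠ j → ∀ x : L, ∃ y : L, g (x • (b i + b j)) = y • (b i + b j) := by
    intro i j hij
    refine hfix' (Pi.single i 1 + Pi.single j 1) _ (fun h => ?_)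
      (by simp [Pi.single_apply, apply_ite (algebraMap K L), ite_smul, add_smul,
        Finset.sum_add_distrib])
    have := congrArg (b.coord i) h
    simp [hij.symm] at this
  let f : L →ₗ[K] L := (b.coord 0).restrictScalars K ∘ₗ (g : V →ₗ[K] V) ∘ₗ
    ((LinearMap.toSpanSingleton L V (b 0)).restrictScalars K)
  have hf : ∀ x, f x = b.coord 0 (g (x • b 0)) := fun x => rfl
  have hf0 : ∀ x, g (x • b 0) = f x • b 0 := by
    intro x
    obtain ⟨y, hy⟩ := h1 0 x
    rw [hf, hy]
    simp
  refine ⟨f, fun x i => ?_⟩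
  by_cases hi : i = 0
  · rw [hi, hf0]
  obtain ⟨y, hy⟩ := h1 i x
  obtain ⟨z, hz⟩ := h2 i 0 hi x
  rw [smul_add, map_add, hy, hf0, smul_add] at hz
  have e1 := congrArg (b.coord i) hz
  have e2 := congrArg (b.coord 0) hz
  simp [hi, Ne.symm hi] at e1 e2
  rw [hy, e1, e2]

/-- An inducing linear map acts on the coordinates as a multiple of a `K`-automorphism of `L`. -/
theorem IsInducedBy.exists_algHom {g : V ≃ₗ[K] V} {φ : Equiv.Perm (ℙ L V)}
    (hg : IsInducedBy g φ) (b : Module.Basis (Fin 3) L V)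
    (hfix : ∀ (k : Fin 3 → K) (h : ∑ i, algebraMap K L (k i) • b i ≠ 0),
      φ (Projectivization.mk L _ h) = Projectivization.mk L _ h) :
    ∃ (θ : L →ₐ[K] L) (c : L), c ≠ 0 ∧ ∀ x i, g (x • b i) = (c * θ x) • b i := by
  obtain ⟨f, hf⟩ := hg.exists_map_smul_basis b hfix
  have hc : f 1 ≠ 0 := by
    intro h
    have := hf 1 0
    rw [h, zero_smul, one_smul, map_eq_zero_iff g g.injective] at this
    exact b.ne_zero 0 this
  -- `g` carries the `L`-line of `b 0 + t • b 1` to an `L`-line, so both coordinates scale by the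
  -- same `y`.
  have hmul : ∀ x t, f x * f t = f (x * t) * f 1 := by
    intro x t
    obtain ⟨y, hy⟩ := hg.exists_map_smul x (b 0 + t • b 1)
    have h10 : g (b 0) = f 1 • b 0 := by simpa using hf 1 0
    rw [smul_add, map_add, map_add, smul_smul, hf, hf, hf, h10, smul_add, smul_smul,
      smul_smul] at hy
    have e1 := congrArg (b.coord 0) hy
    have e2 := congrArg (b.coord 1) hy
    simp at e1 e2
    rw [e1, e2]
    ring
  refine ⟨AlgHom.ofLinearMap ((f 1)⁻¹ • f) (by simp [hc]) fun x t => ?_, f 1, hc, fun x i => ?_⟩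
  · simp only [LinearMap.smul_apply, smul_eq_mul]
    have h := hmul x t
    field_simp
    linear_combination -h
  · simp [hf, hc]

/-- Otherwise `g` is multiplication by `c`, which fixes every point of `ℙ L V`. -/
theorem IsInducedBy.algHom_ne_id {g : V ≃ₗ[K] V} {φ : Equiv.Perm (ℙ L V)}
    (hg : IsInducedBy g φ) {b : Module.Basis (Fin 3) L V} {θ : L →ₐ[K] L} {c : L}
    (h : ∀ x i, g (x • b i) = (c * θ x) • b i) (hφ : φ ≠ 1) : ∃ t, θ t ≠ t := by
  by_contra! hθ
  refine hφ (Equiv.ext fun P => ?_)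
  induction P using Projectivization.ind with | h v hv =>
  rw [hg.apply_mk, Equiv.Perm.one_apply, Projectivization.mk_eq_mk_iff']
  refine ⟨c, ?_⟩
  conv_rhs => rw [← b.sum_repr v, map_sum_smul h]
  simp only [hθ, mul_smul, ← Finset.smul_sum, b.sum_repr]

/-- `φ³` sends the point with coordinates `(1, t, 0)` to `(1, θ³ t, 0)`. -/
theorem IsInducedBy.algHom_pow_three {g : V ≃ₗ[K] V} {φ : Equiv.Perm (ℙ L V)}
    (hg : IsInducedBy g φ) {b : Module.Basis (Fin 3) L V} {θ : L →ₐ[K] L} {c : L} (hc : c ≠ 0)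
    (h : ∀ x i, g (x • b i) = (c * θ x) • b i) (hφ : φ ^ 3 = 1) (t : L) :
    θ (θ (θ t)) = t := by
  have hv : b 0 + t • b 1 ≠ 0 := by
    intro h0
    simpa using congrArg (b.coord 0) h0
  have h3 := Equiv.congr_fun hφ (Projectivization.mk L _ hv)
  have e : ∀ P, (φ ^ 3) P = φ (φ (φ P)) := fun P => rfl
  rw [e, hg.apply_mk, hg.apply_mk, hg.apply_mk, Equiv.Perm.one_apply,
    Projectivization.mk_eq_mk_iff'] at h3
  obtain ⟨y, hy⟩ := h3
  have h11 : g (b 0) = c • b 0 := by simpa using h 1 0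
  simp only [map_add, h, h11, smul_add, smul_smul] at hy
  have e1 := congrArg (b.coord 0) hy
  have e2 := congrArg (b.coord 1) hy
  simp at e1 e2
  rw [e1] at e2
  have hθc : ∀ x, x ≠ 0 → θ x ≠ 0 := fun x hx => (map_ne_zero θ).2 hx
  have hne : c * (θ c * θ (θ c)) ≠ 0 :=
    mul_ne_zero hc (mul_ne_zero (hθc _ hc) (hθc _ (hθc _ hc)))
  apply mul_left_cancel₀ hne
  linear_combination -e2

end Semilinear

/-! ### Automorphisms of a cubic extension -/

section Cubic

variable {K L : Type*} [Field K] [Field L] [Algebra K L]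

/-- In an extension of degree 3, an endomorphism other than the identity fixes `K` only. -/
theorem mem_range_algebraMap_of_fixed (hL : Module.finrank K L = 3) {θ : L →ₐ[K] L} {t : L}
    (ht : θ t ≠ t) {x : L} (hx : θ x = x) : ∃ k : K, algebraMap K L k = x := by
  -- Prime degree leaves no intermediate algebra for the fixed elements to form.
  have := Subalgebra.isSimpleOrder_of_finrank_prime K L (hL ▸ Nat.prime_three)
  have hx' : x ∈ AlgHom.equalizer θ (AlgHom.id K L) := hx
  rcases eq_bot_or_eq_top (AlgHom.equalizer θ (AlgHom.id K L)) with h | h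
  · rw [h] at hx'
    exact Algebra.mem_bot.1 hx'
  · refine absurd ?_ ht
    have : t ∈ AlgHom.equalizer θ (AlgHom.id K L) := h ▸ Algebra.mem_top
    exact this

/-- Independence of the powers of an automorphism of order 3. -/
theorem exists_combination_ne_zero {θ : L →ₐ[K] L} {t : L} (ht : θ t ≠ t)
    (h3 : ∀ x, θ (θ (θ x)) = x) {α β γ : L} (hα : α ≠ 0) :
    ∃ x, α * θ (θ x) + β * θ x + γ * x ≠ 0 := by
  have hinj : Function.Injective
      ![(θ : L →* L), (θ : L →* L).comp (θ : L →* L), MonoidHom.id L] := by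
    have h01 : (θ : L →* L) ≠ (θ : L →* L).comp (θ : L →* L) := fun h =>
      ht (θ.injective (DFunLike.congr_fun h t).symm)
    have h02 : (θ : L →* L) ≠ MonoidHom.id L := fun h => ht (DFunLike.congr_fun h t)
    have h12 : (θ : L →* L).comp (θ : L →* L) ≠ MonoidHom.id L := fun h => ht (by
      have := DFunLike.congr_fun h (θ t)
      exact (this.symm.trans (h3 t)))
    intro i j hij
    fin_cases i <;> fin_cases j <;> simp_all [Ne.symm]
  have hli := (linearIndependent_monoidHom L L).comp _ hinj
  by_contra! h
  have := Fintype.linearIndependent_iff.1 hli ![β, α, γ] (by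
    ext x
    simp [Fin.sum_univ_three]
    linear_combination h x) 1
  exact hα (by simpa using this)

end Cubic

/-! ### Eigenspaces of the inducing map -/

section Spectrum

variable {K L V : Type*} [Field K] [Field L] [Algebra K L] [AddCommGroup V]
  [Module L V] [Module K V] [IsScalarTower K L V]

theorem exists_map_map_map_eq_smul (hL : Module.finrank K L = 3) {g : V ≃ₗ[K] V}
    {b : Module.Basis (Fin 3) L V} {θ : L →ₐ[K] L} {c t : L} (ht : θ t ≠ t)
    (h3 : ∀ x, θ (θ (θ x)) = x) (h : ∀ x i, g (x • b i) = (c * θ x) • b i) :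
    ∃ n : K, ∀ v, g (g (g v)) = n • v := by
  obtain ⟨n, hn⟩ := mem_range_algebraMap_of_fixed hL ht (x := c * θ c * θ (θ c)) (by
    simp only [map_mul, h3]
    ring)
  refine ⟨n, fun v => ?_⟩
  rw [← b.sum_repr v, map_sum_smul h, map_sum_smul h, map_sum_smul h, Finset.smul_sum]
  refine Finset.sum_congr rfl fun i _ => ?_
  rw [← algebraMap_smul L n, smul_smul, hn]
  simp only [map_mul, h3]
  congr 1
  ring

/-- As in Hilbert 90, a nonzero value `w` of the cofactor on a coordinate axis solves `c * θ w = a *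
w`. Any other solution is a `K`-multiple of `w`, the ratio being fixed by `θ`, so the eigenspace has
`K`-basis `w • b i`. -/
theorem finrank_range_subScalar (hL : Module.finrank K L = 3) {g : V ≃ₗ[K] V}
    {b : Module.Basis (Fin 3) L V} {θ : L →ₐ[K] L} {c t : L} (hc : c ≠ 0) (ht : θ t ≠ t)
    (h3 : ∀ x, θ (θ (θ x)) = x) (h : ∀ x i, g (x • b i) = (c * θ x) • b i)
    (hV : Module.finrank K V = 9) {a : K} (hg : ∀ v, g (g (g v)) = a ^ 3 • v) :
    HasProjDim (LinearMap.range (subScalar g a)) 5 ∧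
      LinearMap.ker (cofactor g a) ≤ LinearMap.range (subScalar g a) := by
  have : FiniteDimensional K V := .of_finrank_pos (by omega)
  obtain ⟨x, hx⟩ := exists_combination_ne_zero ht h3 (α := c * θ c)
    (β := algebraMap K L a * c) (γ := algebraMap K L a ^ 2)
    (mul_ne_zero hc ((map_ne_zero θ).2 hc))
  set w := c * θ c * θ (θ x) + algebraMap K L a * c * θ x + algebraMap K L a ^ 2 * x with hw
  have hcof : ∀ i, cofactor g a (x • b i) = w • b i := by
    intro i
    rw [cofactor_apply, h, h, ← algebraMap_smul L a, ← algebraMap_smul L (a ^ 2), hw, map_pow,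
      map_mul]
    module
  let ι : (Fin 3 → K) →ₗ[K] V := Fintype.linearCombination K fun i => w • b i
  have hι : ∀ k, ι k = ∑ i, (algebraMap K L (k i) * w) • b i := by
    intro k
    simp [ι, Fintype.linearCombination_apply, mul_smul, algebraMap_smul]
  have hιinj : Function.Injective ι := by
    rw [injective_iff_map_eq_zero]
    intro k hk
    rw [hι] at hk
    funext i
    have := Fintype.linearIndependent_iff.1 b.linearIndependent _ hk i
    simpa [hx] using this
  have hwa : c * θ w = algebraMap K L a * w := by
    have h1 := subScalar_cofactor hg (x • b 0)
    rw [hcof, subScalar_apply, h, ← algebraMap_smul L a, smul_smul, ← sub_smul,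
      smul_eq_zero_iff_left (b.ne_zero 0)] at h1
    exact sub_eq_zero.1 h1
  have hker : LinearMap.ker (subScalar g a) ≤ LinearMap.range ι := by
    intro v hv
    have hθv : ∀ i, c * θ (b.repr v i) = algebraMap K L a * b.repr v i := by
      rw [LinearMap.mem_ker, subScalar_apply, ← b.sum_repr v, map_sum_smul h, Finset.smul_sum,
        ← Finset.sum_sub_distrib] at hv
      simp only [← algebraMap_smul L a, smul_smul, ← sub_smul] at hv
      exact fun i => sub_eq_zero.1 (Fintype.linearIndependent_iff.1 b.linearIndependent _ hv i)
    have hfix : ∀ i, ∃ k : K, algebraMap K L k = b.repr v i / w := by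
      intro i
      refine mem_range_algebraMap_of_fixed hL ht ?_
      have hw' : θ w ≠ 0 := (map_ne_zero θ).2 hx
      rw [map_div₀, div_eq_div_iff hw' hx]
      apply mul_left_cancel₀ hc
      have ha0 := hθv i
      linear_combination w * ha0 - b.repr v i * hwa
    choose k hk using hfix
    refine ⟨k, ?_⟩
    rw [hι]
    conv_rhs => rw [← b.sum_repr v]
    simp [hk, hx]
  have hle : LinearMap.range ι ≤ LinearMap.range (cofactor g a) := by
    rintro _ ⟨k, rfl⟩
    refine ⟨∑ i, k i • x • b i, ?_⟩
    simp only [map_sum, map_smul, hcof]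
    rfl
  have hle' : LinearMap.range (cofactor g a) ≤ LinearMap.ker (subScalar g a) := by
    rintro _ ⟨v, rfl⟩
    exact subScalar_cofactor hg v
  have hrange : LinearMap.range (subScalar g a) ≤ LinearMap.ker (cofactor g a) := by
    rintro _ ⟨v, rfl⟩
    exact cofactor_subScalar hg v
  -- The chain `ker (g - a) ≤ range ι ≤ range (cofactor) ≤ ker (g - a)` collapses to dimension 3;
  -- rank-nullity in dimension 9 gives 6 for both the image of `g - a` and the kernel of the
  -- cofactor.
  have hr := LinearMap.finrank_range_of_inj hιinj
  rw [Module.finrank_fin_fun] at hr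
  have i1 := Submodule.finrank_mono hker
  have i2 := Submodule.finrank_mono hle
  have i3 := Submodule.finrank_mono hle'
  have j1 := (subScalar g a).finrank_range_add_finrank_ker
  have j2 := (cofactor g a).finrank_range_add_finrank_ker
  refine ⟨by unfold HasProjDim; omega, ?_⟩
  exact (Submodule.eq_of_le_of_finrank_eq hrange (by omega)).ge

end Spectrum

/-! ### From points of the projective space to vectors -/

section Points

variable {K V : Type*} [Field K] [AddCommGroup V] [Module K V]

@[simp]
theorem proj_mk (g : V ≃ₗ[K] V) (v : V) (hv : v ≠ 0) :
    proj g (Projectivization.mk K v hv) =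
      Projectivization.mk K (g v) (g.map_ne_zero_iff.2 hv) :=
  rfl

theorem linearIndependent_of_proj_ne {g : V ≃ₗ[K] V} {v : V} (hv : v ≠ 0)
    (h : Projectivization.mk K v hv ≠ proj g (Projectivization.mk K v hv)) :
    LinearIndependent K ![v, g v] :=
  (Projectivization.independent_mk_iff_LinearIndependent hv (g.map_ne_zero_iff.2 hv)).1
    ((Projectivization.independent_pair_iff_ne _ _).2 h)

theorem exists_eq_add_of_collinearPoints {g : V ≃ₗ[K] V} {v : V} (hv : v ≠ 0)
    (hli : LinearIndependent K ![v, g v])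
    (h : CollinearPoints (Projectivization.mk K v hv) (proj g (Projectivization.mk K v hv))
      (proj g (proj g (Projectivization.mk K v hv)))) :
    ∃ α β : K, g (g v) = α • g v + β • v := by
  obtain ⟨M, hfin, hM, hsub⟩ := h
  have hgv : g v ≠ 0 := g.map_ne_zero_iff.2 hv
  have hggv : g (g v) ≠ 0 := g.map_ne_zero_iff.2 hgv
  have m1 : v ∈ M.submodule := (M.mem_submodule_iff hv).2 (hsub (by simp))
  have m2 : g v ∈ M.submodule := (M.mem_submodule_iff hgv).2 (hsub (by simp))
  have m3 : g (g v) ∈ M.submodule := (M.mem_submodule_iff hggv).2 (hsub (by simp))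
  have hle : Submodule.span K {g v, v} ≤ M.submodule := by
    rw [Submodule.span_le]
    rintro x (rfl | rfl)
    exacts [m2, m1]
  have hspan : Module.finrank K (Submodule.span K {g v, v}) = 2 := by
    rw [Set.pair_comm, ← Matrix.range_cons_cons_empty v (g v) ![]]
    simp [finrank_span_eq_card hli]
  have heq := Submodule.eq_of_le_of_finrank_le hle (by omega)
  rw [← heq, Submodule.mem_span_pair] at m3
  obtain ⟨α, β, h⟩ := m3
  exact ⟨α, β, h.symm⟩

variable {L : Type*} [Field L] [Algebra K L] [Module L V] [IsScalarTower K L V]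

/-- A fixed `A` would lie in the spread planes of both `P` and `φ P`, and distinct spread planes are
disjoint. -/
theorem IsIIPoint.ne_proj {φ : Equiv.Perm (ℙ L V)} {g : V ≃ₗ[K] V} (hg : IsInducedBy g φ)
    {A : ℙ K V} (hA : IsIIPoint φ A) : A ≠ proj g A := by
  obtain ⟨P, hP, hAP⟩ := hA
  intro h
  induction A using Projectivization.ind with | h v hv =>
  have hvP : v ∈ P.submodule := hAP (by simp [Submodule.mem_span_singleton_self])
  obtain ⟨k, hk⟩ := (Projectivization.mk_eq_mk_iff' K v (g v) hv (g.map_ne_zero_iff.2 hv)).1 h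
  have hvP' : v ∈ (spreadPlane K (φ P)) := by
    rw [← hk]
    exact Submodule.smul_mem _ k (hg.apply_mem hvP)
  exact hP.1 ((eq_mk_of_mem_submodule hv hvP).trans (eq_mk_of_mem_submodule hv hvP').symm)

theorem ne_proj_and_collinearPoints {φ : Equiv.Perm (ℙ L V)} {g : V ≃ₗ[K] V}
    (hg : IsInducedBy g φ) {A : ℙ K V} (hA : IsIColonPoint φ g A ∨ IsIIColonPoint φ g A) :
    A ≠ proj g A ∧ CollinearPoints A (proj g A) (proj g (proj g A)) := by
  rcases hA with hA | hA
  · exact ⟨hA.2.1, hA.2.2.2.2⟩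
  · exact ⟨hA.1.ne_proj hg, hA.2⟩

end Points

/-- Recording that `U` also contains the image of `A` is what lets fixed lines be treated;
uniqueness needs `A` alone. -/
theorem exists_isHwiseFixed5Space_of_point {K L V : Type*} [Field K]
    [Field L] [Algebra K L] (hL : Module.finrank K L = 3)
    [AddCommGroup V] [Module L V] [Module K V] [IsScalarTower K L V]
    (hV : Module.finrank L V = 3)
    (φ : Equiv.Perm (ℙ L V)) (hφ3 : orderOf φ = 3)
    (S : Set (ℙ L V)) (hS : IsSubplane K S) (hφS : ∀ P ∈ S, φ P = P)
    (σ : V ≃ₗ[K] V) (hσ : IsInducedBy σ φ) {A : ℙ K V}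
    (hA : IsIColonPoint φ σ A ∨ IsIIColonPoint φ σ A) :
    ∃ U : Submodule K V, (IsHwiseFixed5Space σ U ∧ A.submodule ≤ U ∧ (proj σ A).submodule ≤ U) ∧
      ∀ W, IsHwiseFixed5Space σ W → A.submodule ≤ W → W = U := by
  obtain ⟨b, rfl⟩ := hS
  have hVK : Module.finrank K V = 9 := by
    rw [← Module.finrank_mul_finrank K L V, hL, hV]
  have : FiniteDimensional K V := .of_finrank_pos (by omega)
  have hφ1 : φ ≠ 1 := by
    rintro rfl
    simp at hφ3
  obtain ⟨θ, c, hc, h⟩ := hσ.exists_algHom b fun k hk => hφS _ ⟨k, hk, rfl⟩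
  obtain ⟨t, ht⟩ := hσ.algHom_ne_id h hφ1
  have h3 := hσ.algHom_pow_three hc h (hφ3 ▸ pow_orderOf_eq_one φ)
  obtain ⟨n, hn⟩ := exists_map_map_map_eq_smul hL ht h3 h
  obtain ⟨hne, hcol⟩ := ne_proj_and_collinearPoints hσ hA
  induction A using Projectivization.ind with | h v hv =>
  have hli := linearIndependent_of_proj_ne hv hne
  have key := existsUnique_isHwiseFixed5Space_mem hVK hn (fun a ha =>
    finrank_range_subScalar hL hc ht h3 h hVK (by simpa [ha] using hn)) hli
    (exists_eq_add_of_collinearPoints hv hli hcol)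
  simpa [Submodule.span_singleton_le_iff_mem] using key

end FieldReduction

theorem theorem10 (q : ℕ) (hq : 2 < q)
    {K L V : Type*} [Field K] [Finite K] (hK : Nat.card K = q)
    [Field L] [Algebra K L] (hL : Module.finrank K L = 3)
    [AddCommGroup V] [Module L V] [Module K V] [IsScalarTower K L V]
    (hV : Module.finrank L V = 3)
    (φ : Equiv.Perm (ℙ L V)) (hφ : FieldReduction.IsCollineation φ) (hφ3 : orderOf φ = 3)
    (S : Set (ℙ L V)) (hS : FieldReduction.IsSubplane K S) (hφS : ∀ P ∈ S, φ P = P)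
    (σ : V ≃ₗ[K] V) (hσ : FieldReduction.IsInducedBy σ φ) :
    (∀ A : ℙ K V, FieldReduction.IsIColonPoint φ σ A ∨ FieldReduction.IsIIColonPoint φ σ A →
      ∃! U : Submodule K V, FieldReduction.IsHwiseFixed5Space σ U ∧ A.submodule ≤ U) ∧
    (∀ l : Submodule K V, FieldReduction.IsFixedILine φ σ l ∨ FieldReduction.IsFixedIILine φ σ l →
      ∃! U : Submodule K V, FieldReduction.IsHwiseFixed5Space σ U ∧ l ≤ U) := by
  constructor
  · intro A hA
    obtain ⟨U, ⟨hU, hAU, -⟩, huniq⟩ :=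
      FieldReduction.exists_isHwiseFixed5Space_of_point hL hV φ hφ3 S hS hφS σ hσ hA
    exact ⟨U, ⟨hU, hAU⟩, fun W hW => huniq W hW.1 hW.2⟩
  · intro l hl
    obtain ⟨hdim, hfix, A, hA, hAl⟩ : FieldReduction.HasProjDim l 1 ∧ FieldReduction.Fixes σ l ∧
        ∃ A : ℙ K V, (FieldReduction.IsIColonPoint φ σ A ∨ FieldReduction.IsIIColonPoint φ σ A) ∧
          A.submodule ≤ l := by
      rcases hl with ⟨h1, h2, A, hA, h3⟩ | ⟨h1, h2, A, hA, h3⟩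
      exacts [⟨h1, h2, A, .inl hA, h3⟩, ⟨h1, h2, A, .inr hA, h3⟩]
    obtain ⟨U, ⟨hU, hAU, hAU'⟩, huniq⟩ :=
      FieldReduction.exists_isHwiseFixed5Space_of_point hL hV φ hφ3 S hS hφS σ hσ hA
    refine ⟨U, ⟨hU, ?_⟩, fun W hW => huniq W hW.1 (hAl.trans hW.2)⟩
    have hne := (FieldReduction.ne_proj_and_collinearPoints hσ hA).1
    clear huniq hA
    induction A using Projectivization.ind with | h v hv =>
    have hvl : v ∈ l := hAl (by simp [Submodule.mem_span_singleton_self])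
    have hσl : σ v ∈ l := by
      rw [← hfix]
      exact Submodule.mem_map_of_mem hvl
    -- The fixed line is the span of `v` and `σ v`, both already in `U`.
    rw [Projectivization.line_unique' hv (σ.map_ne_zero_iff.2 hv)
      (FieldReduction.linearIndependent_of_proj_ne hv hne) l hdim
      ((Submodule.mk_mem_projectivization_iff _ _).2 hvl)
      ((Submodule.mk_mem_projectivization_iff _ _).2 hσl), Submodule.span_le]
    rintro x (rfl | rfl)
    · exact hAU (by simp [Submodule.mem_span_singleton_self])
    · exact hAU' (by simp [Submodule.mem_span_singleton_self])
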